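/- Let $n\ge 0$ and let $\Phi\colon\mathbb{R}\times X\to X$ be a smooth ($C^\infty$) flow on a connected compact smooth $n$-dimensional manifold $X$ (without boundary). Let $T^n=(\mathbb{R}/\mathbb{Z})^n$ be the $n$-torus with its standard smooth structure. Assume that there exist a smooth map $F\colon X\to T^n$ and a vector $\omega\in\mathbb{R}^n$ with rationally independent components (i.e. linearly independent over $\mathbb{Q}$) such that $$F(\Phi^t(x))=\omega t+F(x)\mod 1\qquad\text{for all } x\in X,\ t\in\mathbb{R}.$$ Then there is a vector $\tilde\omega\in\mathbb{R}^n$ with rationally independent components such that $(X,\Phi)$ is smoothly conjugate to the flow $(t,y)\mapsto \tilde\omega t+y \mod 1$ of the constant vector field $\tilde\omega$ on $T^n$, i.e. there is a $C^\infty$ diffeomorphism $h\colon X\to T^n$ with $h\circ\Phi^t(x)=\tilde\omega t+h(x)\mod 1$ for all $x\in X$, $t\in\mathbb{R}$. Moreover, $(X,\Phi)$ is linearizable by a smooth embedding: there are $m\in\mathbb{N}$, a smooth embedding $G\colon X\to\mathbb{R}^m$ and a matrix $B\in\mathbb{R}^{m\times m}$ such that $G\circ\Phi^t=e^{Bt}\circ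 G$ for all $t\in\mathbb{R}$. -/

import Mathlib

open Set Filter Topology Manifold
open scoped ContDiff Matrix

noncomputable section

namespace TorusFlow

/-! ### The torus `Tⁿ = (ℝ/ℤ)ⁿ` as a smooth manifold -/

/-- Reduction mod 1, entrywise: the projection `ℝⁿ → Tⁿ`. -/
def torusMk {n : ℕ} (v : Fin n → ℝ) : UnitAddTorus (Fin n) := fun i => (v i : UnitAddCircle)

/-- The restriction of `torusMk` to the open unit cube `∏ᵢ (aᵢ, aᵢ + 1)`, as an open partial
homeomorphism from `ℝⁿ` to `Tⁿ`. -/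
def torusCube {n : ℕ} (a : Fin n → ℝ) :
    OpenPartialHomeomorph (Fin n → ℝ) (UnitAddTorus (Fin n)) :=
  OpenPartialHomeomorph.pi fun i => AddCircle.openPartialHomeomorphCoe (1 : ℝ) (a i)

theorem torusCube_apply {n : ℕ} (a v : Fin n → ℝ) : torusCube a v = torusMk v := rfl

theorem torusCube_source {n : ℕ} (a : Fin n → ℝ) :
    (torusCube a).source = Set.pi univ fun i => Ioo (a i) (a i + 1) := rfl

/-- The lower corner of a unit cube whose centre projects to `x`. -/
def torusCorner {n : ℕ} (x : UnitAddTorus (Fin n)) : Fin n → ℝ :=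
  fun i => (AddCircle.equivIco (1 : ℝ) 0 (x i) : ℝ) - 1 / 2

theorem mem_torusCube_target {n : ℕ} (x : UnitAddTorus (Fin n)) :
    x ∈ (torusCube (torusCorner x)).target := by
  have hx : torusMk (fun i => (AddCircle.equivIco (1 : ℝ) 0 (x i) : ℝ)) = x := by
    funext i
    exact (AddCircle.equivIco (1 : ℝ) 0).symm_apply_apply (x i)
  have h := (torusCube (torusCorner x)).map_source
    (x := fun i => (AddCircle.equivIco (1 : ℝ) 0 (x i) : ℝ)) (by
      rw [torusCube_source]
      intro i _
      constructor <;> simp only [torusCorner] <;> linarith)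
  rwa [torusCube_apply, hx] at h

/-- The charts of `Tⁿ` are the local inverses of the projection `ℝⁿ → Tⁿ` over open unit cubes. -/
instance torusChartedSpace (n : ℕ) : ChartedSpace (Fin n → ℝ) (UnitAddTorus (Fin n)) where
  atlas := Set.range fun a : Fin n → ℝ => (torusCube a).symm
  chartAt x := (torusCube (torusCorner x)).symm
  mem_chart_source x := mem_torusCube_target x
  chart_mem_atlas x := ⟨torusCorner x, rfl⟩

/-- Two convergent families with the same projection to the torus differ eventually by the
difference of their limits. -/
theorem eventually_eq_add_of_torusMk_eq {α : Type*} {n : ℕ} {l : Filter α}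
    {f g : α → Fin n → ℝ} {a b : Fin n → ℝ} (hf : Tendsto f l (𝓝 a)) (hg : Tendsto g l (𝓝 b))
    (hab : torusMk a = torusMk b) (h : ∀ᶠ y in l, torusMk (f y) = torusMk (g y)) :
    ∀ᶠ y in l, f y = g y + (a - b) := by
  have key : ∀ u v : Fin n → ℝ, torusMk u = torusMk v → ∀ i, ∃ m : ℤ, u i - v i = m := by
    intro u v huv i
    have h1 : ((u i - v i : ℝ) : UnitAddCircle) = 0 := by
      rw [AddCircle.coe_sub, sub_eq_zero]; exact congrFun huv i
    obtain ⟨m, hm⟩ := (AddCircle.coe_eq_zero_iff (1 : ℝ)).1 h1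
    exact ⟨m, by rw [← hm]; simp⟩
  have hd : ∀ᶠ y in l, dist (f y - g y) (a - b) < 1 :=
    (hf.sub hg).eventually (Metric.ball_mem_nhds _ one_pos)
  filter_upwards [hd, h] with y hy hmk
  funext i
  obtain ⟨m, hm⟩ := key _ _ hmk i
  obtain ⟨k, hk⟩ := key _ _ hab i
  have h2 : dist ((f y - g y) i) ((a - b) i) < 1 := lt_of_le_of_lt (dist_le_pi_dist _ _ i) hy
  rw [Pi.sub_apply, Pi.sub_apply, hm, hk, Real.dist_eq] at h2
  have h3 : |m - k| < 1 := by exact_mod_cast h2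
  have h4 : m = k := by rw [Int.abs_lt_one_iff] at h3; omega
  have h5 : f y i - g y i = a i - b i := by rw [hm, hk, h4]
  simp only [Pi.add_apply, Pi.sub_apply]
  linarith

instance torusIsManifold (n : ℕ) (k : ℕ∞ω) :
    IsManifold 𝓘(ℝ, Fin n → ℝ) k (UnitAddTorus (Fin n)) := by
  apply isManifold_of_contDiffOn
  rintro _ _ ⟨a, rfl⟩ ⟨b, rfl⟩ v hv
  have hv' : v ∈ ((torusCube a).symm.symm.trans (torusCube b).symm).source := by simpa using hv
  have hmk : ∀ w ∈ ((torusCube a).symm.symm.trans (torusCube b).symm).source,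
      torusMk (((torusCube a).symm.symm.trans (torusCube b).symm) w) = torusMk w := by
    intro w hw
    have hw2 : torusCube a w ∈ (torusCube b).target := by
      simpa [OpenPartialHomeomorph.trans_source] using hw.2
    exact (torusCube b).right_inv hw2
  have hev : ∀ᶠ w in 𝓝 v, ((torusCube a).symm.symm.trans (torusCube b).symm) w
      = w + (((torusCube a).symm.symm.trans (torusCube b).symm) v - v) :=
    eventually_eq_add_of_torusMk_eq (OpenPartialHomeomorph.continuousAt _ hv') tendsto_id
      (hmk v hv')
      (((OpenPartialHomeomorph.open_source _).eventually_mem hv').mono fun w hw => hmk w hw)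
  refine ContDiffAt.contDiffWithinAt ?_
  exact (contDiffAt_id.add contDiffAt_const).congr_of_eventuallyEq hev

/-! ### Linear flows on the torus -/

/-- The vector field on `Tⁿ` with constant value `w` with respect to the parallelization
`T(Tⁿ) = Tⁿ × ℝⁿ` (transition maps between the charts are locally translations, so the
coordinate expression of this field is `w` in every chart). -/
def constantField {n : ℕ} (w : Fin n → ℝ) (y : UnitAddTorus (Fin n)) :
    TangentSpace 𝓘(ℝ, Fin n → ℝ) y := w

theorem continuous_torusMk {n : ℕ} : Continuous (torusMk (n := n)) :=
  continuous_pi fun i => (AddCircle.continuous_mk' (1 : ℝ)).comp (continuous_apply i)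

theorem torusMk_add {n : ℕ} (u v : Fin n → ℝ) : torusMk (u + v) = torusMk u + torusMk v := by
  funext i; simp [torusMk]

/-- The linear flow `(t, y) ↦ w t + y mod 1` on `Tⁿ`. -/
def linearFlow {n : ℕ} (w : Fin n → ℝ) : Flow ℝ (UnitAddTorus (Fin n)) where
  toFun t y := torusMk (t • w) + y
  cont' := by
    have h : Continuous fun p : ℝ × UnitAddTorus (Fin n) => torusMk (p.1 • w) + p.2 :=
      (continuous_torusMk.comp (continuous_fst.smul continuous_const)).add continuous_snd
    exact h
  map_add' s t y := by rw [add_smul, torusMk_add, add_assoc]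
  map_zero' y := by funext i; simp [torusMk]

/-- The linear flow with frequency vector `w` is the flow of the constant vector field `w`. -/
theorem isMIntegralCurve_linearFlow {n : ℕ} (w : Fin n → ℝ) (y : UnitAddTorus (Fin n)) :
    IsMIntegralCurve (fun t => linearFlow w t y) (constantField w) := by
  intro t₀
  have hc : Continuous fun t : ℝ => linearFlow w t y :=
    (linearFlow w).continuous continuous_id continuous_const
  refine ⟨hc.continuousAt, ?_⟩
  set z := linearFlow w t₀ y with hz
  set e := torusCube (torusCorner z) with he
  have hy : torusMk (e.symm z - t₀ • w) = y := by
    have h1 : torusMk (e.symm z) = z := e.right_inv (mem_torusCube_target z)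
    have h2 : torusMk (t₀ • w) + torusMk (e.symm z - t₀ • w) = torusMk (t₀ • w) + y := by
      rw [← torusMk_add, add_sub_cancel, h1]; rfl
    exact add_left_cancel h2
  have hev : ∀ᶠ t in 𝓝 t₀, e.symm (linearFlow w t y)
      = (t • w + (e.symm z - t₀ • w)) + (e.symm z - (t₀ • w + (e.symm z - t₀ • w))) := by
    refine eventually_eq_add_of_torusMk_eq (a := e.symm z) ?_ ?_ ?_ ?_
    · exact (e.continuousAt_symm (mem_torusCube_target z)).tendsto.comp hc.continuousAt
    · have : Continuous fun t : ℝ => t • w + (e.symm z - t₀ • w) := by fun_prop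
      exact this.tendsto t₀
    · rw [add_sub_cancel]
    · filter_upwards [hc.continuousAt.eventually
        (e.open_target.eventually_mem (mem_torusCube_target z))] with t ht
      have h1 : torusMk (e.symm (linearFlow w t y)) = linearFlow w t y := e.right_inv ht
      rw [h1, torusMk_add, hy]; rfl
  have hd : HasDerivAt (fun t : ℝ => e.symm (linearFlow w t y)) w t₀ := by
    refine HasDerivAt.congr_of_eventuallyEq ?_ hev
    simpa using (((hasDerivAt_id t₀).smul_const w).add_const
      (e.symm z - t₀ • w)).add_const (e.symm z - (t₀ • w + (e.symm z - t₀ • w)))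
  exact hd.hasFDerivAt.hasFDerivWithinAt

/-! ### Smooth flows, conjugacies and linearizations -/

section

variable {E H X : Type*} [NormedAddCommGroup E] [NormedSpace ℝ E] [TopologicalSpace H]
  [TopologicalSpace X] [ChartedSpace H X]

/-- A flow `Φ : ℝ × X → X` is smooth if it is `C^∞` jointly in time and space. -/
def IsSmoothFlow (I : ModelWithCorners ℝ E H) (Φ : Flow ℝ X) : Prop :=
  ContMDiff (𝓘(ℝ, ℝ).prod I) I ∞ fun p : ℝ × X => Φ p.1 p.2

/-- A flow `Φ` on `X` is smoothly conjugate to a flow `Ψ` on `Y` if some `C^∞` diffeomorphism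
`h : X → Y` satisfies `h ∘ Φᵗ = Ψᵗ ∘ h` for all `t`. -/
def SmoothlyConjugate {E' H' Y : Type*} [NormedAddCommGroup E'] [NormedSpace ℝ E']
    [TopologicalSpace H'] [TopologicalSpace Y] [ChartedSpace H' Y]
    (I : ModelWithCorners ℝ E H) (J : ModelWithCorners ℝ E' H')
    (Φ : Flow ℝ X) (Ψ : Flow ℝ Y) : Prop :=
  ∃ h : Diffeomorph I J X Y ∞, ∀ (t : ℝ) (x : X), h (Φ t x) = Ψ t (h x)

/-- `(X, Φ)` is linearizable by a smooth embedding: there are a smooth embedding `F : X → ℝᵐ` and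
a real `m × m` matrix `B` such that `F ∘ Φᵗ = e^{Bt} ∘ F` for all `t`. -/
def LinearizableBySmoothEmbedding (I : ModelWithCorners ℝ E H) (Φ : Flow ℝ X) : Prop :=
  ∃ (m : ℕ) (F : X → EuclideanSpace ℝ (Fin m)) (B : Matrix (Fin m) (Fin m) ℝ),
    IsSmoothEmbedding I (𝓡 m) ∞ F ∧
      ∀ (t : ℝ) (x : X), F (Φ t x) = WithLp.toLp 2 (NormedSpace.exp (t • B) *ᵥ (F x).ofLp)

end

end TorusFlow

end

/-! The key point is that `F` has no critical points. Since `F` intertwines the diffeomorphism `Φ t`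
with a translation, being a local diffeomorphism at a point propagates along its orbit. The critical
set is therefore invariant, and its image is a compact subset of Tⁿ that is invariant under an
irrational linear flow. By Kronecker (`eq_univ_of_isClosed_of_invariant`, via Weyl averages) this
image is empty or all of Tⁿ. By Sard in equal dimensions (`volume_preimage_torusMk_image_critical`)
it is a null set, hence empty.

Being a local diffeomorphism from a compact Hausdorff space, `F` is a covering map. A translate of
the projection ℝⁿ → Tⁿ lifts through `F` to `p : ℝⁿ → X`, which is surjective because `X` is
connected. Thus `X` is ℝⁿ/Λ, where the group Λ of periods of `p` is a sublattice of ℤⁿ of full rank.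
Coordinates in a basis of Λ identify `X` with Tⁿ (`exists_diffeomorph_torus`). The flow lifts to
translation by `t • w`, so it becomes linear, its frequencies being the coordinates of `w` in that
basis. They stay rationally independent because the basis vectors are integral.

Finally, Tⁿ embeds in ℝ²ⁿ by cosines and sines. There a linear flow rotates each coordinate plane at
constant speed, so it is the exponential of a matrix. -/

noncomputable section

namespace TorusFlow

/-! ### Local diffeomorphisms -/

section LocalDiffeo

variable {E E' E'' H H' H'' M N P : Type*}
  [NormedAddCommGroup E] [NormedSpace ℝ E] [NormedAddCommGroup E'] [NormedSpace ℝ E']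
  [NormedAddCommGroup E''] [NormedSpace ℝ E'']
  [TopologicalSpace H] [TopologicalSpace H'] [TopologicalSpace H'']
  {I : ModelWithCorners ℝ E H} {J : ModelWithCorners ℝ E' H'} {K : ModelWithCorners ℝ E'' H''}
  [TopologicalSpace M] [ChartedSpace H M] [TopologicalSpace N] [ChartedSpace H' N]
  [TopologicalSpace P] [ChartedSpace H'' P]

/-- A `C^n` open partial homeomorphism with `C^n` inverse, as a partial diffeomorphism. -/
def partialDiffeomorphOfContMDiffOn {n : ℕ∞ω} (e : OpenPartialHomeomorph M N)
    (he : ContMDiffOn I J n e e.source) (he' : ContMDiffOn J I n e.symm e.target) :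
    PartialDiffeomorph I J M N n where
  toPartialEquiv := e.toPartialEquiv
  open_source := e.open_source
  open_target := e.open_target
  contMDiffOn_toFun := he
  contMDiffOn_invFun := he'

theorem isLocalDiffeomorphAt_of_contMDiffOn {n : ℕ∞ω} {f : M → N} {x : M}
    (e : OpenPartialHomeomorph M N) (hx : x ∈ e.source) (hf : EqOn f e e.source)
    (he : ContMDiffOn I J n e e.source) (he' : ContMDiffOn J I n e.symm e.target) :
    IsLocalDiffeomorphAt I J n f x :=
  ⟨partialDiffeomorphOfContMDiffOn e he he', hx, hf⟩

theorem _root_.IsLocalDiffeomorphAt.exists_openPartialHomeomorph {n : ℕ∞ω} {f : M → N} {x : M}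
    (h : IsLocalDiffeomorphAt I J n f x) :
    ∃ e : OpenPartialHomeomorph M N, x ∈ e.source ∧ EqOn f e e.source ∧
      ContMDiffOn I J n e e.source ∧ ContMDiffOn J I n e.symm e.target := by
  obtain ⟨Φ, hx, hf⟩ := h
  exact ⟨Φ.toOpenPartialHomeomorph, hx, hf, Φ.contMDiffOn_toFun, Φ.contMDiffOn_invFun⟩

theorem _root_.IsLocalDiffeomorphAt.congr {n : ℕ∞ω} {f g : M → N} {x : M}
    (h : IsLocalDiffeomorphAt I J n f x) (hfg : g =ᶠ[𝓝 x] f) :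
    IsLocalDiffeomorphAt I J n g x := by
  obtain ⟨e, hx, hf, he, he'⟩ := h.exists_openPartialHomeomorph
  obtain ⟨U, hU, hUo, hxU⟩ := eventually_nhds_iff.1 hfg
  refine isLocalDiffeomorphAt_of_contMDiffOn (e.restrOpen U hUo) ⟨hx, hxU⟩ ?_ ?_ ?_
  · intro y hy
    exact (hU y hy.2).trans (hf hy.1)
  · exact he.mono fun y hy => hy.1
  · refine he'.mono fun y hy => ?_
    have := (e.restrOpen U hUo).map_target hy
    have h2 := (e.restrOpen U hUo).right_inv hy
    rw [← h2]
    exact e.map_source this.1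

theorem isOpen_setOf_isLocalDiffeomorphAt {n : ℕ∞ω} (f : M → N) :
    IsOpen {x | IsLocalDiffeomorphAt I J n f x} := by
  rw [isOpen_iff_mem_nhds]
  rintro x ⟨Φ, hx, hf⟩
  filter_upwards [Φ.open_source.mem_nhds hx] with y hy
  exact ⟨Φ, hy, hf⟩

/-- If `f` and `g ∘ f` are local diffeomorphisms at `x`, then so is `g` at `f x`. -/
theorem _root_.IsLocalDiffeomorphAt.of_comp_right {n : ℕ∞ω} {f : M → N} {g : N → P} {x : M}
    (hf : IsLocalDiffeomorphAt I J n f x) (hgf : IsLocalDiffeomorphAt I K n (g ∘ f) x) :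
    IsLocalDiffeomorphAt J K n g (f x) := by
  have hx : hf.localInverse (f x) = x := hf.localInverse_left_inv hf.localInverse_mem_target
  -- Near `f x`, `g` agrees with `(g ∘ f) ∘ f⁻¹` for the local inverse of `f`.
  have h1 := hf.localInverse_isLocalDiffeomorphAt.comp K P (g := g ∘ f) (by rwa [hx])
  refine h1.congr ?_
  filter_upwards [hf.localInverse_eventuallyEq_right] with y hy
  simp only [Function.comp_apply, id] at hy ⊢
  rw [hy]

/-- If `g ∘ f` is a local diffeomorphism at `x`, `g` one at `f x` and `f` is continuous at `x`,
then `f` is a local diffeomorphism at `x`. -/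
theorem _root_.IsLocalDiffeomorphAt.of_comp_left {n : ℕ∞ω} {f : M → N} {g : N → P} {x : M}
    (hg : IsLocalDiffeomorphAt J K n g (f x)) (hgf : IsLocalDiffeomorphAt I K n (g ∘ f) x)
    (hf : ContinuousAt f x) : IsLocalDiffeomorphAt I J n f x := by
  have h1 := hgf.comp J N (g := hg.localInverse) hg.localInverse_isLocalDiffeomorphAt
  refine h1.congr ?_
  filter_upwards [hf.eventually hg.localInverse_eventuallyEq_left] with y hy
  exact hy.symm

theorem isLocalDiffeomorphAt_of_mem_maximalAtlas {n : ℕ∞ω}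
    {e : OpenPartialHomeomorph M H} [IsManifold I n M] (he : e ∈ IsManifold.maximalAtlas I n M)
    {x : M} (hx : x ∈ e.source) : IsLocalDiffeomorphAt I I n e x :=
  isLocalDiffeomorphAt_of_contMDiffOn e hx (fun _ _ => rfl)
    (contMDiffOn_of_mem_maximalAtlas he) (contMDiffOn_symm_of_mem_maximalAtlas he)

theorem isLocalDiffeomorphAt_symm_of_mem_maximalAtlas {n : ℕ∞ω}
    {e : OpenPartialHomeomorph M H} [IsManifold I n M] (he : e ∈ IsManifold.maximalAtlas I n M)
    {y : H} (hy : y ∈ e.target) : IsLocalDiffeomorphAt I I n e.symm y :=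
  isLocalDiffeomorphAt_of_contMDiffOn e.symm hy (fun _ _ => rfl)
    (contMDiffOn_symm_of_mem_maximalAtlas he) (by
      rw [e.symm_symm]
      exact contMDiffOn_of_mem_maximalAtlas he)

/-- The inverse function theorem: a smooth map between Banach spaces with invertible derivative
at `a` is a local diffeomorphism at `a`. -/
theorem isLocalDiffeomorphAt_of_hasFDerivAt [CompleteSpace E] {f : E → E'} {U : Set E}
    (hU : IsOpen U) (hf : ContDiffOn ℝ ∞ f U) {a : E} (ha : a ∈ U) {f' : E ≃L[ℝ] E'}
    (hf' : HasFDerivAt f (f' : E →L[ℝ] E') a) :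
    IsLocalDiffeomorphAt 𝓘(ℝ, E) 𝓘(ℝ, E') ∞ f a := by
  have hfa : ∀ x ∈ U, ContDiffAt ℝ ∞ f x := fun x hx => hf.contDiffAt (hU.mem_nhds hx)
  have h0 : (∞ : ℕ∞ω) ≠ 0 := by simp
  set e := (hfa a ha).toOpenPartialHomeomorph f hf' h0 with he
  have hea : a ∈ e.source := (hfa a ha).mem_toOpenPartialHomeomorph_source hf' h0
  -- Invertibility is an open condition, so the derivative stays invertible near `a`. This makes the
  -- inverse smooth on a whole neighbourhood, not only at `f a`.
  have hV : ∀ᶠ x in 𝓝 a, fderiv ℝ f x ∈ range ((↑) : (E ≃L[ℝ] E') → E →L[ℝ] E') := by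
    have hc : ContinuousAt (fderiv ℝ f) a :=
      ((hfa a ha).fderiv_right (m := 0) (by simp)).continuousAt
    refine hc.eventually ?_
    rw [hf'.fderiv]
    exact ContinuousLinearEquiv.nhds f'
  obtain ⟨V, hV, hVo, haV⟩ := eventually_nhds_iff.1 hV
  have hUV : IsOpen (U ∩ V) := hU.inter hVo
  set e1 := e.restrOpen (U ∩ V) hUV with he1
  refine isLocalDiffeomorphAt_of_contMDiffOn e1 ⟨hea, ha, haV⟩ (fun _ _ => rfl) ?_ ?_
  · rw [contMDiffOn_iff_contDiffOn]
    exact hf.mono fun x hx => hx.2.1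
  · rw [contMDiffOn_iff_contDiffOn]
    intro y hy
    obtain ⟨hx1, hxU, hxV⟩ := e1.map_target hy
    obtain ⟨g', hg'⟩ := hV _ hxV
    refine (e1.contDiffAt_symm hy (f₀' := g') ?_ ?_).contDiffWithinAt
    · have := ((hfa _ hxU).differentiableAt h0).hasFDerivAt
      rw [← hg'] at this
      exact this
    · exact hfa _ hxU

theorem isLocalDiffeomorph_of_continuousLinearEquiv (A : E ≃L[ℝ] E') :
    IsLocalDiffeomorph 𝓘(ℝ, E) 𝓘(ℝ, E') ∞ A :=
  A.toDiffeomorph.isLocalDiffeomorph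

end LocalDiffeo

/-! ### The projection onto the torus -/

section Torus

variable {n : ℕ}

theorem torusMk_zero : torusMk (0 : Fin n → ℝ) = 0 := by
  funext i; simp [torusMk]

theorem torusMk_sub (u v : Fin n → ℝ) : torusMk (u - v) = torusMk u - torusMk v := by
  funext i; simp [torusMk]

theorem torusMk_surjective : Function.Surjective (torusMk (n := n)) := by
  intro y
  choose v hv using fun i => QuotientAddGroup.mk_surjective (y i)
  exact ⟨v, funext hv⟩

theorem torusMk_eq_zero_iff {v : Fin n → ℝ} : torusMk v = 0 ↔ ∀ i, ∃ m : ℤ, v i = m := by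
  rw [funext_iff]
  refine forall_congr' fun i => ?_
  have : torusMk v i = ((v i : ℝ) : UnitAddCircle) := rfl
  rw [this, Pi.zero_apply, AddCircle.coe_eq_zero_iff]
  simp [eq_comm]

theorem torusMk_eq_torusMk_iff {u v : Fin n → ℝ} :
    torusMk u = torusMk v ↔ ∀ i, ∃ m : ℤ, u i - v i = m := by
  rw [← sub_eq_zero, ← torusMk_sub, torusMk_eq_zero_iff]
  rfl

theorem torusCube_symm_mem_maximalAtlas (a : Fin n → ℝ) :
    (torusCube a).symm ∈ IsManifold.maximalAtlas 𝓘(ℝ, Fin n → ℝ) ∞ (UnitAddTorus (Fin n)) :=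
  IsManifold.subset_maximalAtlas ⟨a, rfl⟩

theorem isLocalDiffeomorph_torusMk :
    IsLocalDiffeomorph 𝓘(ℝ, Fin n → ℝ) 𝓘(ℝ, Fin n → ℝ) ∞ (torusMk (n := n)) := by
  intro v
  -- The shift by 1/2 centres the unit cube at `v`.
  have hv : v ∈ (torusCube (v - fun _ => 1 / 2)).source := by
    rw [torusCube_source]
    intro i _
    constructor <;> simp only [Pi.sub_apply] <;> linarith
  exact isLocalDiffeomorphAt_symm_of_mem_maximalAtlas
    (torusCube_symm_mem_maximalAtlas (v - fun _ => 1 / 2)) (y := v) hv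

theorem isLocalDiffeomorph_torus_add (c : UnitAddTorus (Fin n)) :
    IsLocalDiffeomorph 𝓘(ℝ, Fin n → ℝ) 𝓘(ℝ, Fin n → ℝ) ∞ (fun y => c + y) := by
  intro y
  obtain ⟨v, rfl⟩ := torusMk_surjective y
  obtain ⟨u, rfl⟩ := torusMk_surjective c
  refine (isLocalDiffeomorph_torusMk v).of_comp_right ?_
  have h1 : IsLocalDiffeomorphAt 𝓘(ℝ, Fin n → ℝ) 𝓘(ℝ, Fin n → ℝ) ∞ (fun w => u + w) v := by
    refine isLocalDiffeomorphAt_of_hasFDerivAt isOpen_univ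
      (contDiff_const.add contDiff_id).contDiffOn (mem_univ _)
      (f' := ContinuousLinearEquiv.refl ℝ _) ?_
    exact (hasFDerivAt_id v).const_add u
  have h2 := h1.comp _ _ (isLocalDiffeomorph_torusMk (u + v))
  refine h2.congr (Eventually.of_forall fun w => ?_)
  simp [torusMk_add]

end Torus

/-! ### Density of linear flows with rationally independent frequencies -/

section Kronecker

open MeasureTheory UnitAddTorus

variable {n : ℕ}

theorem mFourier_torusMk (k : Fin n → ℤ) (v : Fin n → ℝ) :
    mFourier k (torusMk v) = Complex.exp (2 * Real.pi * Complex.I * (∑ i, (k i : ℝ) * v i : ℝ)) := by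
  have : mFourier k (torusMk v) = ∏ i, fourier (k i) ((v i : ℝ) : UnitAddCircle) := rfl
  rw [this]
  simp only [fourier_coe_apply]
  rw [← Complex.exp_sum]
  congr 1
  push_cast
  rw [Finset.mul_sum]
  refine Finset.sum_congr rfl fun i _ => ?_
  simp only [div_one]
  ring

/-- Absence of resonances: this is the only way in which rational independence enters Weyl's
theorem. -/
theorem sum_intCast_mul_ne_zero {w : Fin n → ℝ} (hw : LinearIndependent ℚ w) {k : Fin n → ℤ}
    (hk : k ≠ 0) : ∑ i, (k i : ℝ) * w i ≠ 0 := by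
  intro h
  apply hk
  have h1 := Fintype.linearIndependent_iff.1 hw (fun i => (k i : ℚ)) (by
    rw [← h]
    refine Finset.sum_congr rfl fun i _ => ?_
    rw [Rat.smul_def]; simp)
  funext i
  exact_mod_cast h1 i

/-- The normalised Haar measure on `Tⁿ`. -/
abbrev torusMeasure (n : ℕ) : Measure (UnitAddTorus (Fin n)) :=
  Measure.pi fun _ => AddCircle.haarAddCircle

/-- A nontrivial character is orthogonal to the trivial one. -/
theorem integral_mFourier_of_ne_zero {k : Fin n → ℤ} (hk : k ≠ 0) :
    ∫ y, mFourier k y ∂torusMeasure n = 0 := by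
  have h := (orthonormal_iff_ite.1 (orthonormal_mFourier (d := Fin n))) 0 k
  rw [if_neg (Ne.symm hk)] at h
  simp only [ContinuousMap.inner_toLp, ← mFourier_neg, ← mFourier_add, neg_zero, add_zero] at h
  exact h

/-- The time average over `[0, T]` of `g` along the linear flow `w` started at `y`. -/
def timeAverage (w : Fin n → ℝ) (y : UnitAddTorus (Fin n)) (g : C(UnitAddTorus (Fin n), ℂ))
    (T : ℝ) : ℂ :=
  (T : ℂ)⁻¹ * ∫ t in (0 : ℝ)..T, g (torusMk (t • w) + y)

theorem continuous_comp_linear (w : Fin n → ℝ) (y : UnitAddTorus (Fin n))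
    (g : C(UnitAddTorus (Fin n), ℂ)) : Continuous fun t : ℝ => g (torusMk (t • w) + y) := by
  have h : Continuous fun t : ℝ => torusMk (t • w) :=
    continuous_torusMk.comp (continuous_id.smul continuous_const)
  exact g.continuous.comp (h.add continuous_const)

theorem timeAverage_sub (w : Fin n → ℝ) (y : UnitAddTorus (Fin n))
    (f g : C(UnitAddTorus (Fin n), ℂ)) (T : ℝ) :
    timeAverage w y (f - g) T = timeAverage w y f T - timeAverage w y g T := by
  simp only [timeAverage, ContinuousMap.sub_apply]
  rw [intervalIntegral.integral_sub ((continuous_comp_linear w y f).intervalIntegrable _ _)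
    ((continuous_comp_linear w y g).intervalIntegrable _ _), mul_sub]

theorem norm_timeAverage_le (w : Fin n → ℝ) (y : UnitAddTorus (Fin n))
    (g : C(UnitAddTorus (Fin n), ℂ)) {T : ℝ} (hT : 0 < T) : ‖timeAverage w y g T‖ ≤ ‖g‖ := by
  have h := intervalIntegral.norm_integral_le_of_norm_le_const (a := 0) (b := T) (C := ‖g‖)
    (f := fun t : ℝ => g (torusMk (t • w) + y)) fun t _ => g.norm_coe_le_norm _
  rw [sub_zero, abs_of_pos hT] at h
  rw [timeAverage, norm_mul, norm_inv, Complex.norm_real, Real.norm_of_nonneg hT.le]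
  rw [inv_mul_le_iff₀ hT, mul_comm]
  exact h

theorem norm_integral_torus_le (g : C(UnitAddTorus (Fin n), ℂ)) :
    ‖∫ y, g y ∂torusMeasure n‖ ≤ ‖g‖ := by
  have := norm_integral_le_of_norm_le_const (μ := torusMeasure n)
    (Eventually.of_forall fun y => g.norm_coe_le_norm y)
  simpa using this

theorem integrable_torus (g : C(UnitAddTorus (Fin n), ℂ)) : Integrable g (torusMeasure n) :=
  g.continuous.integrable_of_hasCompactSupport (HasCompactSupport.of_compactSpace _)

/-- Along an orbit a character is a constant times `exp (c t)`, with `c` imaginary and nonzero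
unless `k = 0`. Its integral over `[0, T]` is then bounded uniformly in `T`, and division by `T`
sends it to 0. -/
theorem tendsto_timeAverage_mFourier {w : Fin n → ℝ} (hw : LinearIndependent ℚ w)
    (y : UnitAddTorus (Fin n)) (k : Fin n → ℤ) :
    Tendsto (timeAverage w y (mFourier k)) atTop (𝓝 (∫ z, mFourier k z ∂torusMeasure n)) := by
  by_cases hk : k = 0
  · subst hk
    refine tendsto_const_nhds.congr' ?_
    filter_upwards [eventually_gt_atTop 0] with T hT
    have : (T : ℂ) ≠ 0 := by exact_mod_cast hT.ne'
    simp [timeAverage, mFourier_zero, this]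
  · rw [integral_mFourier_of_ne_zero hk]
    obtain ⟨v, rfl⟩ := torusMk_surjective y
    set s : ℝ := ∑ i, (k i : ℝ) * w i with hs
    have hs0 : s ≠ 0 := sum_intCast_mul_ne_zero hw hk
    set c : ℂ := 2 * Real.pi * Complex.I * s with hc
    have hc0 : c ≠ 0 := by
      simp [hc, Real.pi_ne_zero, hs0]
    have hval : ∀ t : ℝ, mFourier k (torusMk (t • w) + torusMk v)
        = mFourier k (torusMk v) * Complex.exp (c * t) := by
      intro t
      rw [← torusMk_add, mFourier_torusMk, mFourier_torusMk, ← Complex.exp_add]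
      congr 1
      have : ∑ i, (k i : ℝ) * (t • w + v) i = s * t + ∑ i, (k i : ℝ) * v i := by
        rw [hs, Finset.sum_mul, ← Finset.sum_add_distrib]
        refine Finset.sum_congr rfl fun i _ => ?_
        simp only [Pi.add_apply, Pi.smul_apply, smul_eq_mul]
        ring
      rw [this, hc]
      push_cast
      ring
    have hnorm : ∀ t : ℝ, ‖Complex.exp (c * t)‖ = 1 := by
      intro t
      have : c * t = ((2 * Real.pi * s * t : ℝ) : ℂ) * Complex.I := by
        rw [hc]; push_cast; ring
      rw [this, Complex.norm_exp_ofReal_mul_I]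
    have hbound : ∀ᶠ T : ℝ in atTop,
        ‖timeAverage w (torusMk v) (mFourier k) T‖ ≤ T⁻¹ * (‖mFourier k (torusMk v)‖ * (2 / ‖c‖)) := by
      filter_upwards [eventually_gt_atTop 0] with T hT
      rw [timeAverage]
      simp only [hval]
      rw [intervalIntegral.integral_const_mul, integral_exp_mul_complex hc0, norm_mul, norm_mul,
        norm_div, norm_inv, Complex.norm_real, Real.norm_of_nonneg hT.le]
      gcongr
      refine (norm_sub_le _ _).trans ?_
      rw [hnorm, hnorm]
      norm_num
    refine squeeze_zero_norm' hbound ?_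
    simpa using tendsto_inv_atTop_zero.mul_const (‖mFourier k (torusMk v)‖ * (2 / ‖c‖))

/-- Weyl's theorem: time averages of continuous functions along a linear flow with rationally
independent frequencies converge to the space average. -/
theorem tendsto_timeAverage {w : Fin n → ℝ} (hw : LinearIndependent ℚ w)
    (y : UnitAddTorus (Fin n)) (g : C(UnitAddTorus (Fin n), ℂ)) :
    Tendsto (timeAverage w y g) atTop (𝓝 (∫ z, g z ∂torusMeasure n)) := by
  have hspan : ∀ f ∈ Submodule.span ℂ (range (mFourier (d := Fin n))),
      Tendsto (timeAverage w y f) atTop (𝓝 (∫ z, f z ∂torusMeasure n)) := by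
    intro f hf
    induction hf using Submodule.span_induction with
    | mem f hf =>
      obtain ⟨k, rfl⟩ := hf
      exact tendsto_timeAverage_mFourier hw y k
    | zero =>
      have : timeAverage w y 0 = fun _ => 0 := by funext T; simp [timeAverage]
      rw [this]; simp
    | add f g _ _ hf hg =>
      have h1 : timeAverage w y (f + g) = fun T => timeAverage w y f T + timeAverage w y g T := by
        funext T
        simp only [timeAverage, ContinuousMap.add_apply]
        rw [intervalIntegral.integral_add ((continuous_comp_linear w y f).intervalIntegrable _ _)
          ((continuous_comp_linear w y g).intervalIntegrable _ _), mul_add]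
      have h2 : ∫ z, (f + g) z ∂torusMeasure n = (∫ z, f z ∂torusMeasure n) + ∫ z, g z ∂torusMeasure n :=
        integral_add (integrable_torus f) (integrable_torus g)
      rw [h1, h2]
      exact hf.add hg
    | smul c f _ hf =>
      have h1 : timeAverage w y (c • f) = fun T => c * timeAverage w y f T := by
        funext T
        simp only [timeAverage, ContinuousMap.smul_apply, smul_eq_mul]
        rw [intervalIntegral.integral_const_mul]
        ring
      have h2 : ∫ z, (c • f) z ∂torusMeasure n = c * ∫ z, f z ∂torusMeasure n := integral_const_mul _ _
      rw [h1, h2]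
      exact hf.const_mul c
  -- Trigonometric polynomials are uniformly dense, and both averages are 1-Lipschitz in the sup
  -- norm, so an ε/3 argument finishes.
  have hg : g ∈ closure (Submodule.span ℂ (range (mFourier (d := Fin n))) :
      Set C(UnitAddTorus (Fin n), ℂ)) := by
    rw [← Submodule.topologicalClosure_coe, span_mFourier_closure_eq_top]
    trivial
  rw [Metric.tendsto_nhds]
  intro ε hε
  obtain ⟨f, hf, hfg⟩ := Metric.mem_closure_iff.1 hg (ε / 3) (by positivity)
  have h1 := Metric.tendsto_nhds.1 (hspan f hf) (ε / 3) (by positivity)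
  filter_upwards [h1, eventually_gt_atTop 0] with T hT hT0
  rw [dist_eq_norm] at hfg hT ⊢
  have h2 : ‖timeAverage w y g T - timeAverage w y f T‖ < ε / 3 := by
    rw [← timeAverage_sub]
    exact (norm_timeAverage_le w y _ hT0).trans_lt hfg
  have h3 : ‖(∫ z, f z ∂torusMeasure n) - ∫ z, g z ∂torusMeasure n‖ < ε / 3 := by
    rw [← integral_sub (integrable_torus f) (integrable_torus g)]
    refine (norm_integral_torus_le (f - g)).trans_lt ?_
    rwa [norm_sub_rev]
  calc ‖timeAverage w y g T - ∫ z, g z ∂torusMeasure n‖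
      = ‖(timeAverage w y g T - timeAverage w y f T) + (timeAverage w y f T - ∫ z, f z ∂torusMeasure n)
          + ((∫ z, f z ∂torusMeasure n) - ∫ z, g z ∂torusMeasure n)‖ := by congr 1; ring
    _ ≤ _ := norm_add₃_le
    _ < ε := by linarith

/-- Kronecker's theorem: a nonempty closed subset of the torus that is invariant under a linear
flow with rationally independent frequencies is the whole torus. -/
theorem eq_univ_of_isClosed_of_invariant {w : Fin n → ℝ} (hw : LinearIndependent ℚ w)
    {K : Set (UnitAddTorus (Fin n))} (hK : IsClosed K) (hne : K.Nonempty)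
    (hinv : ∀ t : ℝ, ∀ y ∈ K, torusMk (t • w) + y ∈ K) : K = univ := by
  obtain ⟨y, hy⟩ := hne
  -- The distance to `K` vanishes along an orbit in `K`, so Weyl's theorem forces its space average
  -- to be 0.
  let f : C(UnitAddTorus (Fin n), ℂ) :=
    ⟨fun z => (Metric.infDist z K : ℂ),
      Complex.continuous_ofReal.comp (Metric.continuous_infDist_pt K)⟩
  have h0 : timeAverage w y f = fun _ => 0 := by
    funext T
    have : ∀ t : ℝ, f (torusMk (t • w) + y) = 0 := fun t => by
      have := Metric.infDist_zero_of_mem (hinv t y hy)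
      simp only [f, ContinuousMap.coe_mk, this, Complex.ofReal_zero]
    simp [timeAverage, this]
  have h1 : ∫ z, f z ∂torusMeasure n = 0 := by
    have := tendsto_timeAverage hw y f
    rw [h0] at this
    exact tendsto_nhds_unique this tendsto_const_nhds
  have h2 : ∫ z, Metric.infDist z K ∂torusMeasure n = 0 := by
    have h3 : ∫ z, f z ∂torusMeasure n = ((∫ z, Metric.infDist z K ∂torusMeasure n : ℝ) : ℂ) := integral_ofReal
    rw [h1] at h3
    exact_mod_cast h3.symm
  have hc : Continuous fun z : UnitAddTorus (Fin n) => Metric.infDist z K :=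
    Metric.continuous_infDist_pt K
  -- Haar measure charges every nonempty open set, so a continuous function that vanishes almost
  -- everywhere vanishes identically.
  have h4 : (fun z => Metric.infDist z K) = fun _ => 0 := by
    refine (hc.ae_eq_iff_eq (torusMeasure n) continuous_const).1 ?_
    exact (integral_eq_zero_iff_of_nonneg (fun z => Metric.infDist_nonneg)
      (hc.integrable_of_hasCompactSupport (HasCompactSupport.of_compactSpace _))).1 h2
  rw [eq_univ_iff_forall]
  intro z
  rw [hK.mem_iff_infDist_zero ⟨y, hy⟩]
  exact congrFun h4 z

end Kronecker

/-! ### Critical values of maps to the torus -/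

section Sard

open MeasureTheory

variable {n : ℕ}

/-- The preimage is covered by the countably many integer translates of `N`. Null sets in Tⁿ can
thus be handled through Lebesgue measure on ℝⁿ. -/
theorem volume_preimage_torusMk_image {N : Set (Fin n → ℝ)} (hN : volume N = 0) :
    volume (torusMk ⁻¹' (torusMk '' N)) = 0 := by
  have hsub : torusMk ⁻¹' (torusMk '' N) ⊆
      ⋃ k : Fin n → ℤ, (fun v => (fun i => (k i : ℝ)) + v) '' N := by
    rintro u ⟨v, hv, huv⟩
    choose k hk using torusMk_eq_torusMk_iff.1 huv.symm
    refine mem_iUnion.2 ⟨k, v, hv, ?_⟩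
    funext i
    simp only [Pi.add_apply]
    linarith [hk i]
  refine measure_mono_null hsub (measure_iUnion_null fun k => ?_)
  rw [image_add_left, measure_preimage_add]
  exact hN

/-- A special case of Sard's theorem: the critical values of a smooth map between vector spaces of
the same dimension form a null set. -/
theorem volume_image_not_isLocalDiffeomorphAt {g : (Fin n → ℝ) → Fin n → ℝ} {U : Set (Fin n → ℝ)}
    (hU : IsOpen U) (hg : ContDiffOn ℝ ∞ g U) :
    volume (g '' {v ∈ U |
      ¬ IsLocalDiffeomorphAt 𝓘(ℝ, Fin n → ℝ) 𝓘(ℝ, Fin n → ℝ) ∞ g v}) = 0 := by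
  have hd : ∀ v ∈ U, HasFDerivAt g (fderiv ℝ g v) v := fun v hv =>
    ((hg.contDiffAt (hU.mem_nhds hv)).differentiableAt (by simp)).hasFDerivAt
  refine addHaar_image_eq_zero_of_det_fderivWithin_eq_zero volume (f' := fderiv ℝ g)
    (fun v hv => (hd v hv.1).hasFDerivWithinAt) ?_
  rintro v ⟨hv, hnot⟩
  by_contra hdet
  apply hnot
  refine isLocalDiffeomorphAt_of_hasFDerivAt hU hg hv
    (f' := (fderiv ℝ g v).toContinuousLinearEquivOfDetNeZero hdet) ?_
  exact hd v hv

variable {X : Type*} [TopologicalSpace X] [ChartedSpace (EuclideanSpace ℝ (Fin n)) X]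
  [IsManifold (𝓡 n) ∞ X]

/-- Sard's theorem for smooth maps from a compact `n`-manifold to `Tⁿ`. -/
theorem volume_preimage_torusMk_image_critical [CompactSpace X] {F : X → UnitAddTorus (Fin n)}
    (hF : ContMDiff (𝓡 n) 𝓘(ℝ, Fin n → ℝ) ∞ F) :
    volume (torusMk ⁻¹'
      (F '' {x | ¬ IsLocalDiffeomorphAt (𝓡 n) 𝓘(ℝ, Fin n → ℝ) ∞ F x})) = 0 := by
  set C := {x | ¬ IsLocalDiffeomorphAt (𝓡 n) 𝓘(ℝ, Fin n → ℝ) ∞ F x} with hC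
  suffices h : volume (torusMk ⁻¹' (F '' (univ ∩ C))) = 0 by rwa [univ_inter] at h
  -- Nullity passes to subsets and finite unions, so by compactness it suffices to treat a
  -- neighbourhood of each point.
  refine isCompact_univ.induction_on (p := fun s => volume (torusMk ⁻¹' (F '' (s ∩ C))) = 0)
    (by simp) ?_ ?_ ?_
  · intro s t hst ht
    exact measure_mono_null
      (preimage_mono (image_mono (inter_subset_inter_left _ hst))) ht
  · intro s t hs ht
    rw [union_inter_distrib_right, image_union, preimage_union]
    exact measure_union_null hs ht
  intro x _
  set φ := chartAt (EuclideanSpace ℝ (Fin n)) x with hφ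
  have hφm : φ ∈ IsManifold.maximalAtlas (𝓡 n) ∞ X := IsManifold.chart_mem_maximalAtlas x
  set e := torusCube (torusCorner (F x)) with he
  have hem := torusCube_symm_mem_maximalAtlas (torusCorner (F x))
  set L := EuclideanSpace.equiv (Fin n) ℝ with hL
  set W := φ.source ∩ F ⁻¹' e.target with hW
  have hWo : IsOpen W := φ.open_source.inter (e.open_target.preimage hF.continuous)
  have hxW : x ∈ W := ⟨mem_chart_source _ x, mem_torusCube_target (F x)⟩
  refine ⟨W, mem_nhdsWithin_of_mem_nhds (hWo.mem_nhds hxW), ?_⟩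
  -- `g` is `F` in local coordinates. Charts and `torusMk` are local diffeomorphisms, so critical
  -- points of `F` in `W` correspond to critical points of `g`.
  set g : (Fin n → ℝ) → Fin n → ℝ := fun v => e.symm (F (φ.symm (L.symm v))) with hg
  set U : Set (Fin n → ℝ) := L.symm ⁻¹' (φ.target ∩ φ.symm ⁻¹' W) with hU
  have hUo : IsOpen U := (φ.isOpen_inter_preimage_symm hWo).preimage L.symm.continuous
  have hgs : ContDiffOn ℝ ∞ g U := by
    rw [← contMDiffOn_iff_contDiffOn]
    have h1 : ContMDiffOn 𝓘(ℝ, Fin n → ℝ) 𝓘(ℝ, Fin n → ℝ) ∞ e.symm e.target :=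
      contMDiffOn_of_mem_maximalAtlas hem
    have h2 : ContMDiffOn (𝓡 n) (𝓡 n) ∞ φ.symm φ.target :=
      contMDiffOn_symm_of_mem_maximalAtlas hφm
    have h3 : ContMDiff 𝓘(ℝ, Fin n → ℝ) (𝓡 n) ∞ L.symm := L.symm.contDiff.contMDiff
    exact h1.comp (hF.comp_contMDiffOn (h2.comp h3.contMDiffOn fun v hv => hv.1))
      fun v hv => hv.2.2
  have hsub : F '' (W ∩ C) ⊆ torusMk '' (g '' {v ∈ U |
      ¬ IsLocalDiffeomorphAt 𝓘(ℝ, Fin n → ℝ) 𝓘(ℝ, Fin n → ℝ) ∞ g v}) := by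
    rintro _ ⟨y, ⟨hyW, hyC⟩, rfl⟩
    have h1 : φ.symm (L.symm (L (φ y))) = y := by
      rw [L.symm_apply_apply, φ.left_inv hyW.1]
    refine ⟨g (L (φ y)), ⟨L (φ y), ⟨?_, fun hloc => hyC ?_⟩, rfl⟩, ?_⟩
    · refine ⟨?_, ?_⟩
      · simpa using φ.map_source hyW.1
      · change φ.symm (L.symm (L (φ y))) ∈ W
        rwa [h1]
    · have h2 : IsLocalDiffeomorphAt (𝓡 n) 𝓘(ℝ, Fin n → ℝ) ∞ (fun z => L (φ z)) y :=
        (isLocalDiffeomorphAt_of_mem_maximalAtlas hφm hyW.1).comp _ _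
          (isLocalDiffeomorph_of_continuousLinearEquiv L (φ y))
      have h3 := (h2.comp _ _ (g := g) hloc).comp _ _ (isLocalDiffeomorph_torusMk _)
      refine h3.congr ?_
      filter_upwards [hWo.mem_nhds hyW] with z hz
      have h4 : e (e.symm (F z)) = F z := e.right_inv hz.2
      simp only [Function.comp_apply, hg, L.symm_apply_apply, φ.left_inv hz.1]
      exact h4.symm
    · have h4 : e (e.symm (F y)) = F y := e.right_inv hyW.2
      simp only [hg, h1]
      exact h4
  exact measure_mono_null (preimage_mono hsub)
    (volume_preimage_torusMk_image (volume_image_not_isLocalDiffeomorphAt hUo hgs))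

end Sard

/-! ### Semiconjugacies to linear flows are coverings -/

section Semiconjugacy

variable {E H X : Type*} [NormedAddCommGroup E] [NormedSpace ℝ E] [TopologicalSpace H]
  [TopologicalSpace X] [ChartedSpace H X] {I : ModelWithCorners ℝ E H}

/-- The time-`t` map of a smooth flow as a diffeomorphism. -/
def IsSmoothFlow.diffeomorph {Φ : Flow ℝ X} (hΦ : IsSmoothFlow I Φ) (t : ℝ) :
    Diffeomorph I I X X ∞ where
  toFun := Φ t
  invFun := Φ (-t)
  left_inv x := by rw [← Φ.map_add, neg_add_cancel, Φ.map_zero_apply]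
  right_inv x := by rw [← Φ.map_add, add_neg_cancel, Φ.map_zero_apply]
  contMDiff_toFun := hΦ.comp (contMDiff_const.prodMk contMDiff_id)
  contMDiff_invFun := hΦ.comp (contMDiff_const.prodMk contMDiff_id)

variable {n : ℕ}

/-- The critical set of a semiconjugacy to a linear flow on the torus is invariant. -/
theorem isLocalDiffeomorphAt_flow {Φ : Flow ℝ X} (hΦ : IsSmoothFlow I Φ)
    {F : X → UnitAddTorus (Fin n)} {w : Fin n → ℝ}
    (hFΦ : ∀ (t : ℝ) (x : X), F (Φ t x) = torusMk (t • w) + F x) {x : X}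
    (hx : IsLocalDiffeomorphAt I 𝓘(ℝ, Fin n → ℝ) ∞ F x) (t : ℝ) :
    IsLocalDiffeomorphAt I 𝓘(ℝ, Fin n → ℝ) ∞ F (Φ t x) := by
  refine IsLocalDiffeomorphAt.of_comp_right ((hΦ.diffeomorph t).isLocalDiffeomorph x) ?_
  refine (hx.comp _ _ (isLocalDiffeomorph_torus_add (torusMk (t • w)) (F x))).congr ?_
  exact Eventually.of_forall fun y => hFΦ t y

end Semiconjugacy

section

variable {n : ℕ} {X : Type*} [TopologicalSpace X] [CompactSpace X]
  [ChartedSpace (EuclideanSpace ℝ (Fin n)) X] [IsManifold (𝓡 n) ∞ X]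

/-- A smooth semiconjugacy from a compact `n`-manifold to a linear flow on `Tⁿ` with rationally
independent frequencies is a local diffeomorphism. -/
theorem isLocalDiffeomorph_of_semiconj {Φ : Flow ℝ X} (hΦ : IsSmoothFlow (𝓡 n) Φ)
    {F : X → UnitAddTorus (Fin n)} (hF : ContMDiff (𝓡 n) 𝓘(ℝ, Fin n → ℝ) ∞ F)
    {w : Fin n → ℝ} (hw : LinearIndependent ℚ w)
    (hFΦ : ∀ (t : ℝ) (x : X), F (Φ t x) = torusMk (t • w) + F x) :
    IsLocalDiffeomorph (𝓡 n) 𝓘(ℝ, Fin n → ℝ) ∞ F := by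
  set C := {x | ¬ IsLocalDiffeomorphAt (𝓡 n) 𝓘(ℝ, Fin n → ℝ) ∞ F x} with hC
  suffices h : ¬ (F '' C).Nonempty by
    intro x
    by_contra hx
    exact h ⟨F x, x, hx, rfl⟩
  intro hne
  have hCc : IsCompact C := by
    have : IsClosed C := (isOpen_setOf_isLocalDiffeomorphAt F).isClosed_compl
    exact this.isCompact
  have huniv : F '' C = univ := by
    refine eq_univ_of_isClosed_of_invariant hw (hCc.image hF.continuous).isClosed hne ?_
    rintro t _ ⟨x, hx, rfl⟩
    refine ⟨Φ t x, fun hreg => hx ?_, hFΦ t x⟩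
    -- If `Φ t x` were regular, flowing back by `-t` would make `x` regular.
    have := isLocalDiffeomorphAt_flow hΦ hFΦ hreg (-t)
    rwa [← Φ.map_add, neg_add_cancel, Φ.map_zero_apply] at this
  have hnull := volume_preimage_torusMk_image_critical hF
  rw [← hC, huniv, preimage_univ] at hnull
  exact (isOpen_univ.measure_pos MeasureTheory.volume univ_nonempty).ne' hnull

end

/-! ### Lifting the projection through a covering of the torus -/

section Lift

variable {n : ℕ} {X : Type*} [TopologicalSpace X] {F : X → UnitAddTorus (Fin n)}

/-- ℝⁿ is simply connected, so maps from it lift through a covering. -/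
theorem exists_lift_torusMk (hF : IsCoveringMap F) (x : X) :
    ∃ p : (Fin n → ℝ) → X, Continuous p ∧ p 0 = x ∧ ∀ v, F (p v) = torusMk v + F x := by
  obtain ⟨p, ⟨hp0, hp⟩, -⟩ := hF.existsUnique_continuousMap_lifts
    (⟨fun v => torusMk v + F x, continuous_torusMk.add continuous_const⟩ :
      C(Fin n → ℝ, UnitAddTorus (Fin n))) 0 x (by simp [torusMk_zero])
  exact ⟨p, p.continuous, hp0, fun v => congrFun hp v⟩

/-- As functions of `w` both sides lift the same map and agree at `w = 0`, so uniqueness of lifts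
applies. Hence the fibres of a lift are cosets of a group of translations. -/
theorem lift_add_eq (hF : IsCoveringMap F) {p q : (Fin n → ℝ) → X} (hp : Continuous p)
    (hq : Continuous q) {c d : UnitAddTorus (Fin n)} (hpF : ∀ v, F (p v) = torusMk v + c)
    (hqF : ∀ v, F (q v) = torusMk v + d) {u v : Fin n → ℝ} (huv : p u = q v) (w : Fin n → ℝ) :
    p (u + w) = q (v + w) := by
  have h : (fun w => p (u + w)) = fun w => q (v + w) := by
    refine hF.eq_of_comp_eq (hp.comp (continuous_const.add continuous_id))
      (hq.comp (continuous_const.add continuous_id)) ?_ 0 (by simpa using huv)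
    funext w
    simp only [Function.comp_apply, hpF, hqF, torusMk_add]
    have := congrArg F huv
    rw [hpF, hqF] at this
    rw [add_right_comm, this, add_right_comm]
  exact congrFun h w

theorem isOpenMap_lift (hF : IsCoveringMap F) {p : (Fin n → ℝ) → X} (hp : Continuous p)
    {c : UnitAddTorus (Fin n)} (hpF : ∀ v, F (p v) = torusMk v + c) : IsOpenMap p := by
  have h1 : IsLocalHomeomorph (F ∘ p) := by
    have h2 : F ∘ p = (Homeomorph.addRight c) ∘ torusMk := by
      funext v; exact hpF v
    rw [h2]
    exact (Homeomorph.addRight c).isLocalHomeomorph.comp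
      isLocalDiffeomorph_torusMk.isLocalHomeomorph
  exact (h1.of_comp hF.isLocalHomeomorph hp).isOpenMap

/-- The range is clopen. It is open because lifts are open maps. It is closed because a point
outside it lies in the open range of a lift through that point, and `lift_add_eq` shows that two
lifts whose ranges meet have the same range. -/
theorem surjective_lift [ConnectedSpace X] (hF : IsCoveringMap F) {p : (Fin n → ℝ) → X}
    (hp : Continuous p) {c : UnitAddTorus (Fin n)} (hpF : ∀ v, F (p v) = torusMk v + c) :
    Function.Surjective p := by
  rw [← range_eq_univ]
  refine IsClopen.eq_univ ⟨?_, (isOpenMap_lift hF hp hpF).isOpen_range⟩ (range_nonempty p)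
  rw [← isOpen_compl_iff, isOpen_iff_mem_nhds]
  intro x hx
  obtain ⟨q, hq, hq0, hqF⟩ := exists_lift_torusMk hF x
  have hxq : x ∈ range q := ⟨0, hq0⟩
  filter_upwards [(isOpenMap_lift hF hq hqF).isOpen_range.mem_nhds hxq]
  rintro _ ⟨u, rfl⟩ ⟨v, hv⟩
  apply hx
  refine ⟨v + -u, ?_⟩
  rw [lift_add_eq hF hp hq hpF hqF hv, add_neg_cancel, hq0]

theorem lift_eq_iff (hF : IsCoveringMap F) {p : (Fin n → ℝ) → X} (hp : Continuous p)
    {c : UnitAddTorus (Fin n)} (hpF : ∀ v, F (p v) = torusMk v + c) {u v : Fin n → ℝ} :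
    p u = p v ↔ p (u - v) = p 0 := by
  constructor <;> intro h
  · simpa [sub_eq_add_neg] using lift_add_eq hF hp hp hpF hpF h (-v)
  · simpa using lift_add_eq hF hp hp hpF hpF h v

/-- The group of periods of a lift of the projection `ℝⁿ → Tⁿ`. -/
def periods (hF : IsCoveringMap F) {p : (Fin n → ℝ) → X} (hp : Continuous p)
    {c : UnitAddTorus (Fin n)} (hpF : ∀ v, F (p v) = torusMk v + c) :
    Submodule ℤ (Fin n → ℝ) :=
  AddSubgroup.toIntSubmodule
    { carrier := {v | p v = p 0}
      zero_mem' := rfl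
      add_mem' := fun {u v} hu hv => by
        have := lift_add_eq hF hp hp hpF hpF hu v
        rw [zero_add] at this
        exact this.trans hv
      neg_mem' := fun {u} hu => by
        have := lift_add_eq hF hp hp hpF hpF hu (-u)
        rw [zero_add, add_neg_cancel] at this
        exact this.symm }

theorem mem_periods (hF : IsCoveringMap F) {p : (Fin n → ℝ) → X} (hp : Continuous p)
    {c : UnitAddTorus (Fin n)} (hpF : ∀ v, F (p v) = torusMk v + c) {v : Fin n → ℝ} :
    v ∈ periods hF hp hpF ↔ p v = p 0 := Iff.rfl

theorem exists_intCast_of_mem_periods (hF : IsCoveringMap F) {p : (Fin n → ℝ) → X}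
    (hp : Continuous p) {c : UnitAddTorus (Fin n)} (hpF : ∀ v, F (p v) = torusMk v + c)
    {v : Fin n → ℝ} (hv : v ∈ periods hF hp hpF) (i : Fin n) : ∃ m : ℤ, v i = m := by
  have h := congrArg F ((mem_periods hF hp hpF).1 hv)
  rw [hpF, hpF, torusMk_zero, add_left_inj] at h
  exact torusMk_eq_zero_iff.1 h i

/-- Periods are integral vectors, and ℤⁿ is discrete. -/
instance discreteTopology_periods (hF : IsCoveringMap F) {p : (Fin n → ℝ) → X}
    (hp : Continuous p) {c : UnitAddTorus (Fin n)} (hpF : ∀ v, F (p v) = torusMk v + c) :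
    DiscreteTopology (periods hF hp hpF) := by
  have hsub : (periods hF hp hpF : Set (Fin n → ℝ)) ⊆
      (Submodule.span ℤ (range (Pi.basisFun ℝ (Fin n))) : Set (Fin n → ℝ)) := by
    intro v hv
    rw [SetLike.mem_coe, Module.Basis.mem_span_iff_repr_mem]
    intro i
    obtain ⟨m, hm⟩ := exists_intCast_of_mem_periods hF hp hpF hv i
    exact ⟨m, by simp [hm]⟩
  have : DiscreteTopology
      (Submodule.span ℤ (range (Pi.basisFun ℝ (Fin n))) : Set (Fin n → ℝ)) :=
    inferInstanceAs (DiscreteTopology (Submodule.span ℤ (range (Pi.basisFun ℝ (Fin n)))))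
  exact DiscreteTopology.of_subset this hsub

/-- The fibres of `F` are compact and discrete, hence finite. By pigeonhole two of the points `p (k
• eᵢ)` with `k` natural coincide, so a nonzero multiple of each basis vector `eᵢ` is a period. -/
theorem isZLattice_periods [CompactSpace X] (hF : IsCoveringMap F) {p : (Fin n → ℝ) → X}
    (hp : Continuous p) {c : UnitAddTorus (Fin n)} (hpF : ∀ v, F (p v) = torusMk v + c) :
    IsZLattice ℝ (periods hF hp hpF) := by
  refine ⟨?_⟩
  rw [← top_le_iff, ← (Pi.basisFun ℝ (Fin n)).span_eq, Submodule.span_le]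
  rintro _ ⟨i, rfl⟩
  have hfin : (F ⁻¹' {c}).Finite := by
    have h1 : DiscreteTopology (F ⁻¹' {c}) := (hF c).discreteTopology_fiber
    have h2 : CompactSpace (F ⁻¹' {c}) :=
      isCompact_iff_compactSpace.1 (isClosed_singleton.preimage hF.continuous).isCompact
    have h3 : Finite (F ⁻¹' {c}) := finite_of_compact_of_discrete
    exact Set.toFinite _
  set b := Pi.basisFun ℝ (Fin n) i with hb
  have hmaps : MapsTo (fun k : ℕ => p ((k : ℝ) • b)) univ (F ⁻¹' {c}) := by
    intro k _
    have : torusMk ((k : ℝ) • b) = 0 := by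
      rw [torusMk_eq_zero_iff]
      intro j
      by_cases hij : j = i
      · subst hij; exact ⟨k, by simp [hb]⟩
      · exact ⟨0, by simp [hb, hij]⟩
    simp [hpF, this]
  obtain ⟨j, -, k, -, hjk, heq⟩ := infinite_univ.exists_ne_map_eq_of_mapsTo hmaps hfin
  have hmem : ((j : ℝ) - k) • b ∈ periods hF hp hpF := by
    rw [mem_periods, sub_smul]
    exact (lift_eq_iff hF hp hpF).1 heq
  have hne : (j : ℝ) - k ≠ 0 := sub_ne_zero.2 (by exact_mod_cast hjk)
  have := Submodule.smul_mem _ ((j : ℝ) - k)⁻¹ (Submodule.subset_span (R := ℝ) hmem)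
  rwa [inv_smul_smul₀ hne] at this

end Lift

/-! ### Coverings of the torus by compact connected manifolds -/

section Conjugacy

variable {n : ℕ}

/-- Each `w j` is an integer combination of the new coordinates. Their ℚ-span therefore contains
that of `w` and has dimension at least `n`. -/
theorem linearIndependent_of_basis_repr {w : Fin n → ℝ} (hw : LinearIndependent ℚ w)
    (b : Module.Basis (Fin n) ℝ (Fin n → ℝ)) (hb : ∀ i j, ∃ m : ℤ, b i j = m) :
    LinearIndependent ℚ (b.equivFun w) := by
  set w' := b.equivFun w with hw'
  rw [linearIndependent_iff_card_le_finrank_span]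
  have hspan : Submodule.span ℚ (range w) ≤ Submodule.span ℚ (range w') := by
    rw [Submodule.span_le]
    rintro _ ⟨j, rfl⟩
    have h1 : w j = ∑ i, w' i * b i j := by
      have := congrFun (b.sum_equivFun w) j
      rw [← this]
      simp [hw']
    rw [SetLike.mem_coe, h1]
    refine Submodule.sum_mem _ fun i _ => ?_
    obtain ⟨m, hm⟩ := hb i j
    have h2 : w' i * b i j = (m : ℚ) • w' i := by
      rw [hm, Rat.smul_def, mul_comm]; simp
    rw [h2]
    exact Submodule.smul_mem _ _ (Submodule.subset_span ⟨i, rfl⟩)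
  have : FiniteDimensional ℚ (Submodule.span ℚ (range w')) :=
    FiniteDimensional.span_of_finite ℚ (finite_range w')
  exact (linearIndependent_iff_card_le_finrank_span.1 hw).trans
    (Submodule.finrank_mono hspan)

variable {E H X : Type*} [NormedAddCommGroup E] [NormedSpace ℝ E] [TopologicalSpace H]
  [TopologicalSpace X] [T2Space X] [CompactSpace X] [ConnectedSpace X] [ChartedSpace H X]
  {I : ModelWithCorners ℝ E H}

/-- A compact connected manifold `X` with a local diffeomorphism `F` to `Tⁿ` is the quotient of
`ℝⁿ` by a full lattice contained in `ℤⁿ`: in coordinates with respect to a basis of this lattice,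
a lift `p : ℝⁿ → X` of the projection to `Tⁿ` induces a diffeomorphism from `X` to `Tⁿ`. -/
theorem exists_diffeomorph_torus {F : X → UnitAddTorus (Fin n)}
    (hF : IsLocalDiffeomorph I 𝓘(ℝ, Fin n → ℝ) ∞ F) :
    ∃ (p : (Fin n → ℝ) → X) (c : UnitAddTorus (Fin n)) (b : Module.Basis (Fin n) ℝ (Fin n → ℝ))
      (h : Diffeomorph I 𝓘(ℝ, Fin n → ℝ) X (UnitAddTorus (Fin n)) ∞),
      Continuous p ∧ Function.Surjective p ∧ (∀ v, F (p v) = torusMk v + c) ∧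
      (∀ i j, ∃ m : ℤ, b i j = m) ∧ ∀ v, h (p v) = torusMk (b.equivFun v) := by
  have hcov : IsCoveringMap F := isLocalHomeomorph_iff_isCoveringMap.1 hF.isLocalHomeomorph
  obtain ⟨x₀⟩ := (inferInstance : Nonempty X)
  obtain ⟨p, hp, -, hpF⟩ := exists_lift_torusMk hcov x₀
  have hsurj := surjective_lift hcov hp hpF
  have hZ := isZLattice_periods hcov hp hpF
  set Λ := periods hcov hp hpF with hΛ
  set b₀ : Module.Basis (Fin n) ℤ Λ := IsZLattice.basis Λ with hb₀
  set b : Module.Basis (Fin n) ℝ (Fin n → ℝ) := b₀.ofZLatticeBasis ℝ with hb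
  -- Two vectors have the same image under `p` exactly when their difference lies in Λ, that is, has
  -- integer coordinates in the basis `b`.
  have hiff : ∀ u v, torusMk (b.equivFun u) = torusMk (b.equivFun v) ↔ p u = p v := by
    intro u v
    rw [lift_eq_iff hcov hp hpF, ← mem_periods hcov hp hpF, torusMk_eq_torusMk_iff, ← hΛ,
      ← b₀.ofZLatticeBasis_span ℝ, Module.Basis.mem_span_iff_repr_mem]
    refine forall_congr' fun i => ?_
    rw [map_sub, Finsupp.sub_apply]
    simp [hb, eq_comm]
  set h : X → UnitAddTorus (Fin n) := fun x => torusMk (b.equivFun (Function.surjInv hsurj x))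
  have hhp : ∀ v, h (p v) = torusMk (b.equivFun v) := fun v =>
    (hiff _ _).2 (Function.surjInv_eq hsurj (p v))
  have hbij : Function.Bijective h := by
    constructor
    · intro x y hxy
      have := (hiff _ _).1 hxy
      rwa [Function.surjInv_eq hsurj, Function.surjInv_eq hsurj] at this
    · intro y
      obtain ⟨v, rfl⟩ := torusMk_surjective y
      refine ⟨p (b.equivFun.symm v), ?_⟩
      rw [hhp, LinearEquiv.apply_symm_apply]
  have hpl : IsLocalDiffeomorph 𝓘(ℝ, Fin n → ℝ) I ∞ p := by
    intro v
    refine (hF (p v)).of_comp_left ?_ hp.continuousAt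
    refine ((isLocalDiffeomorph_torusMk v).comp _ _
      (isLocalDiffeomorph_torus_add (F x₀) (torusMk v))).congr (Eventually.of_forall fun u => ?_)
    simp [hpF, add_comm]
  have hl : IsLocalDiffeomorph I 𝓘(ℝ, Fin n → ℝ) ∞ h := by
    intro x
    obtain ⟨v, rfl⟩ := hsurj x
    refine (hpl v).of_comp_right ?_
    refine ((isLocalDiffeomorph_of_continuousLinearEquiv
      b.equivFun.toContinuousLinearEquiv v).comp _ _ (isLocalDiffeomorph_torusMk _)).congr
      (Eventually.of_forall fun u => ?_)
    exact hhp u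
  refine ⟨p, F x₀, b, hl.diffeomorphOfBijective hbij, hp, hsurj, hpF, fun i j => ?_, hhp⟩
  have hbi : b i ∈ Λ := by
    rw [hb, Module.Basis.ofZLatticeBasis_apply]
    exact (b₀ i).2
  exact exists_intCast_of_mem_periods hcov hp hpF hbi j

theorem exists_smoothlyConjugate_linearFlow {Φ : Flow ℝ X} {F : X → UnitAddTorus (Fin n)}
    (hF : IsLocalDiffeomorph I 𝓘(ℝ, Fin n → ℝ) ∞ F)
    {w : Fin n → ℝ} (hw : LinearIndependent ℚ w)
    (hFΦ : ∀ (t : ℝ) (x : X), F (Φ t x) = torusMk (t • w) + F x) :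
    ∃ w' : Fin n → ℝ, LinearIndependent ℚ w' ∧
      SmoothlyConjugate I 𝓘(ℝ, Fin n → ℝ) Φ (linearFlow w') := by
  obtain ⟨p, c, b, h, hp, hsurj, hpF, hb, hhp⟩ := exists_diffeomorph_torus hF
  refine ⟨b.equivFun w, linearIndependent_of_basis_repr hw b hb, h, fun t x => ?_⟩
  obtain ⟨v, rfl⟩ := hsurj x
  have hcov : IsCoveringMap F := isLocalHomeomorph_iff_isCoveringMap.1 hF.isLocalHomeomorph
  -- Both curves lift the same curve in Tⁿ and start at `p v`.
  have hflow : (fun t => Φ t (p v)) = fun t => p (t • w + v) := by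
    refine hcov.eq_of_comp_eq (Φ.continuous continuous_id continuous_const)
      (hp.comp ((continuous_id.smul continuous_const).add continuous_const)) ?_ 0
      (by simp [Φ.map_zero_apply])
    funext t
    simp only [Function.comp_apply, hFΦ, hpF, torusMk_add, add_assoc]
  rw [congrFun hflow t, hhp, hhp, map_add, map_smul, torusMk_add]
  rfl

end Conjugacy

/-! ### Immersions into Euclidean space -/

section Immersion

variable {E E₂ M : Type*} [NormedAddCommGroup E] [NormedSpace ℝ E] [FiniteDimensional ℝ E]
  [NormedAddCommGroup E₂] [NormedSpace ℝ E₂] [FiniteDimensional ℝ E₂]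
  [TopologicalSpace M] [ChartedSpace E M] [IsManifold 𝓘(ℝ, E) ∞ M]

/-- A map that is smooth with injective derivative in some smooth local parametrization `q` of the
source is an immersion. -/
theorem isImmersionAtOfComplement_of_injective_fderiv {F : Type*} [NormedAddCommGroup F]
    [NormedSpace ℝ F] [FiniteDimensional ℝ F]
    (hdim : Module.finrank ℝ E + Module.finrank ℝ F = Module.finrank ℝ E₂)
    {f : M → E₂} {q : E → M} {a : E}
    (hq : IsLocalDiffeomorphAt 𝓘(ℝ, E) 𝓘(ℝ, E) ∞ q a) (hfq : ContDiff ℝ ∞ (f ∘ q))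
    (hinj : Function.Injective (fderiv ℝ (f ∘ q) a)) :
    IsImmersionAtOfComplement F 𝓘(ℝ, E) 𝓘(ℝ, E₂) ∞ f (q a) := by
  set D := fderiv ℝ (f ∘ q) a with hD
  obtain ⟨V, hV⟩ := Submodule.exists_isCompl (LinearMap.range D.toLinearMap)
  have hVF : Module.finrank ℝ F = Module.finrank ℝ V := by
    have h1 := Submodule.finrank_add_eq_of_isCompl hV
    have h2 := LinearMap.finrank_range_of_inj (f := D.toLinearMap) hinj
    omega
  set c := LinearEquiv.ofFinrankEq F V hVF with hc
  set C : F →L[ℝ] E₂ := (V.subtype ∘ₗ c.toLinearMap).toContinuousLinearMap with hC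
  have hCapp : ∀ v, C v = (c v : E₂) := fun _ => rfl
  set A : E × F →L[ℝ] E₂ := D.coprod C with hA
  have hAinj : Function.Injective A := by
    rw [injective_iff_map_eq_zero]
    rintro ⟨u, v⟩ huv
    have h1 : D u + (c v : E₂) = 0 := huv
    have h2 : D u ∈ LinearMap.range D.toLinearMap := ⟨u, rfl⟩
    have h3 : D u ∈ V := by
      rw [eq_neg_of_add_eq_zero_left h1]
      exact V.neg_mem (c v).2
    have h4 : D u = 0 := Submodule.disjoint_def.1 hV.disjoint _ h2 h3
    have h5 : u = 0 := hinj (by rw [h4, map_zero])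
    rw [h4, zero_add] at h1
    have h6 : v = 0 := by
      apply c.injective
      rw [map_zero]
      exact Subtype.ext h1
    rw [h5, h6]; rfl
  have hfr : Module.finrank ℝ (E × F) = Module.finrank ℝ E₂ := by
    rw [Module.finrank_prod, hdim]
  set A' : (E × F) ≃L[ℝ] E₂ :=
    (LinearEquiv.ofInjectiveOfFinrankEq A.toLinearMap hAinj hfr).toContinuousLinearEquiv with hA'
  have hA'A : (A' : E × F →L[ℝ] E₂) = A := by
    ext x <;> rfl
  -- `ψ` thickens `f ∘ q` in the directions of a complement of the range of its derivative, which
  -- makes the derivative at `(a, 0)` invertible.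
  set ψ : E × F → E₂ := fun z => f (q z.1) + C z.2 with hψ
  have hψs : ContDiff ℝ ∞ ψ := (hfq.comp contDiff_fst).add (C.contDiff.comp contDiff_snd)
  have hψd : HasFDerivAt ψ (A' : E × F →L[ℝ] E₂) (a, 0) := by
    have h1 : HasFDerivAt (f ∘ q) D a :=
      (hfq.contDiffAt.differentiableAt (by simp)).hasFDerivAt
    have h2 : HasFDerivAt (fun z : E × F => (f ∘ q) z.1)
        (D.comp (ContinuousLinearMap.fst ℝ E F)) (a, 0) :=
      HasFDerivAt.comp (g := f ∘ q) (a, (0 : F)) h1 hasFDerivAt_fst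
    have h3 : HasFDerivAt (fun z : E × F => C z.2)
        (C.comp (ContinuousLinearMap.snd ℝ E F)) (a, 0) :=
      C.hasFDerivAt.comp (a, (0 : F)) hasFDerivAt_snd
    have h4 := h2.add h3
    rw [hA'A]
    have h5 : A = D.comp (ContinuousLinearMap.fst ℝ E F) +
        C.comp (ContinuousLinearMap.snd ℝ E F) := by
      ext x <;> simp [hA]
    rw [h5]
    exact h4
  obtain ⟨P, hP0, hPψ, hPs, hPs'⟩ := (isLocalDiffeomorphAt_of_hasFDerivAt isOpen_univ
    hψs.contDiffOn (mem_univ _) hψd).exists_openPartialHomeomorph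
  obtain ⟨Q, hQa, hQq, hQs, hQs'⟩ := hq.exists_openPartialHomeomorph
  set U : Set E := {u | (u, (0 : F)) ∈ P.source} with hU
  have hUo : IsOpen U := P.open_source.preimage (by fun_prop)
  set Q₁ := Q.restrOpen U hUo with hQ₁
  have hqQ : ∀ u ∈ Q₁.source, Q₁ u = q u := fun u hu => (hQq hu.1).symm
  -- In the charts `Q₁⁻¹` on the source and `A' ∘ P⁻¹` on the target, `f` reads `u ↦ A' (u, 0)`,
  -- since `f ∘ q = ψ (·, 0)`.
  refine IsImmersionAtOfComplement.mk_of_charts A' Q₁.symm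
    (P.symm.trans A'.toHomeomorph.toOpenPartialHomeomorph) ?_ ?_ ?_ ?_ ?_ ?_
  · have h1 : a ∈ Q₁.source := ⟨hQa, hP0⟩
    rw [← hqQ a h1]
    exact Q₁.map_source h1
  · have h1 : f (q a) = P (a, 0) := by
      rw [← hPψ hP0]; simp [hψ]
    rw [h1]
    exact ⟨P.map_source hP0, mem_univ _⟩
  · refine OpenPartialHomeomorph.mem_maximalAtlas_of_contMDiffOn (I := 𝓘(ℝ, E)) _ ?_ ?_
    · refine hQs'.mono fun y hy => ?_
      have h1 := Q₁.map_target hy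
      rw [← Q₁.right_inv hy]
      exact Q.map_source h1.1
    · exact hQs.mono fun u hu => hu.1
  · refine OpenPartialHomeomorph.mem_maximalAtlas_of_contMDiffOn (I := 𝓘(ℝ, E₂)) _ ?_ ?_
    · exact A'.contDiff.contMDiff.comp_contMDiffOn (hPs'.mono fun y hy => hy.1)
    · exact hPs.comp A'.symm.contDiff.contMDiff.contMDiffOn fun y hy => hy.2
  · intro y hy
    have h1 := Q₁.map_target hy
    have h2 : f y = P (Q₁.symm y, 0) := by
      rw [← hPψ h1.2]
      simp only [hψ, map_zero, add_zero]
      rw [← hqQ _ h1, Q₁.right_inv hy]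
    rw [mem_preimage, h2]
    exact ⟨P.map_source h1.2, mem_univ _⟩
  · intro u hu
    have hu' : u ∈ Q₁.source := by simpa using hu
    have h2 : f (q u) = P (u, 0) := by
      rw [← hPψ hu'.2]; simp [hψ]
    have h3 : P.symm (f (q u)) = (u, 0) := by rw [h2, P.left_inv hu'.2]
    simp only [Function.comp_apply, mfld_simps]
    change A' (P.symm (f (Q₁ u))) = A' (u, 0)
    rw [hqQ u hu', h3]

end Immersion

/-! ### Linear flows on the torus are linearizable -/

section LinearODE

open scoped Matrix.Norms.Operator

/-- Solutions of the linear differential equation `y' = B y` are `t ↦ e^{tB} y(0)`. -/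
theorem eq_exp_mulVec_of_hasDerivAt {ι : Type*} [Fintype ι] [DecidableEq ι] (B : Matrix ι ι ℝ)
    {y : ℝ → ι → ℝ} (hy : ∀ t, HasDerivAt y (B *ᵥ y t) t) (t : ℝ) :
    y t = NormedSpace.exp (t • B) *ᵥ y 0 := by
  have hexp : ∀ s : ℝ, HasDerivAt (fun s : ℝ => NormedSpace.exp (s • (-B)))
      (NormedSpace.exp (s • (-B)) * (-B)) s := fun s => hasDerivAt_exp_smul_const (-B) s
  let L : Matrix ι ι ℝ →L[ℝ] (ι → ℝ) →L[ℝ] (ι → ℝ) :=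
    LinearMap.toContinuousLinearMap
      (LinearMap.toContinuousLinearMap.toLinearMap ∘ₗ (Matrix.mulVecBilin ℝ ℝ))
  -- By the product rule `e^{-sB} y(s)` is constant; `L` presents `mulVec` as a continuous bilinear
  -- map for this purpose.
  have hz : ∀ s, HasDerivAt (fun s : ℝ => NormedSpace.exp (s • (-B)) *ᵥ y s) 0 s := by
    intro s
    have h1 : HasDerivAt (fun s : ℝ => NormedSpace.exp (s • (-B)) *ᵥ y s)
        ((NormedSpace.exp (s • -B) * -B) *ᵥ y s + NormedSpace.exp (s • -B) *ᵥ B *ᵥ y s) s :=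
      (L.hasFDerivAt.comp_hasDerivAt s (hexp s)).clm_apply (hy s)
    rwa [← Matrix.mulVec_mulVec, ← Matrix.mulVec_add, Matrix.neg_mulVec, neg_add_cancel,
      Matrix.mulVec_zero] at h1
  have hconst := is_const_of_deriv_eq_zero (fun s => (hz s).differentiableAt)
    (fun s => (hz s).deriv) t 0
  simp only [zero_smul, NormedSpace.exp_zero, Matrix.one_mulVec] at hconst
  rw [← hconst, Matrix.mulVec_mulVec, smul_neg, Matrix.exp_neg, Matrix.mul_nonsing_inv,
    Matrix.one_mulVec]
  exact (Matrix.isUnit_iff_isUnit_det _).1 (Matrix.isUnit_exp _)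

end LinearODE

section Embedding

variable {n : ℕ}

/-- The embedding `θ ↦ (cos 2πθ, sin 2πθ)` of `Tⁿ` into `ℝ²ⁿ`. -/
def torusEmbedding (y : UnitAddTorus (Fin n)) : EuclideanSpace ℝ (Fin (n + n)) :=
  WithLp.toLp 2 fun j => Sum.elim (fun i => (fourier 1 (y i) : ℂ).re)
    (fun i => (fourier 1 (y i) : ℂ).im) (finSumFinEquiv.symm j)

theorem continuous_torusEmbedding : Continuous (torusEmbedding (n := n)) := by
  refine (PiLp.continuous_toLp 2 _).comp (continuous_pi fun j => ?_)
  rcases finSumFinEquiv.symm j with i | i <;> simp only [Sum.elim_inl, Sum.elim_inr]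
  · exact Complex.continuous_re.comp ((fourier 1).continuous.comp (continuous_apply i))
  · exact Complex.continuous_im.comp ((fourier 1).continuous.comp (continuous_apply i))

theorem torusEmbedding_injective : Function.Injective (torusEmbedding (n := n)) := by
  intro x y hxy
  have h : ∀ s : Fin n ⊕ Fin n, Sum.elim (fun i => (fourier 1 (x i) : ℂ).re)
      (fun i => (fourier 1 (x i) : ℂ).im) s = Sum.elim (fun i => (fourier 1 (y i) : ℂ).re)
      (fun i => (fourier 1 (y i) : ℂ).im) s := by
    intro s
    have := congrArg (fun v : EuclideanSpace ℝ (Fin (n + n)) => v (finSumFinEquiv s)) hxy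
    simpa [torusEmbedding] using this
  funext i
  have h1 : (fourier 1 (x i) : ℂ) = fourier 1 (y i) :=
    Complex.ext (h (Sum.inl i)) (h (Sum.inr i))
  rw [fourier_one, fourier_one] at h1
  exact AddCircle.injective_toCircle one_ne_zero (Circle.ext h1)

theorem torusEmbedding_torusMk (v : Fin n → ℝ) :
    torusEmbedding (torusMk v) = WithLp.toLp 2 fun j =>
      Sum.elim (fun i => Real.cos (2 * Real.pi * v i)) (fun i => Real.sin (2 * Real.pi * v i))
        (finSumFinEquiv.symm j) := by
  have h : ∀ i, (fourier 1 (torusMk v i) : ℂ) =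
      Complex.exp ((2 * Real.pi * v i : ℝ) * Complex.I) := by
    intro i
    have : torusMk v i = ((v i : ℝ) : UnitAddCircle) := rfl
    rw [this, fourier_coe_apply]
    congr 1
    push_cast
    simp only [div_one]
    ring
  simp only [torusEmbedding, h, Complex.exp_ofReal_mul_I_re, Complex.exp_ofReal_mul_I_im]

theorem contDiff_torusEmbedding_torusMk :
    ContDiff ℝ ∞ fun v : Fin n → ℝ => torusEmbedding (torusMk v) := by
  simp only [torusEmbedding_torusMk]
  rw [contDiff_euclidean]
  intro j
  rcases hj : finSumFinEquiv.symm j with i | i <;> simp only [hj, Sum.elim_inl, Sum.elim_inr]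
  · exact Real.contDiff_cos.comp (contDiff_const.mul (contDiff_apply ℝ ℝ i))
  · exact Real.contDiff_sin.comp (contDiff_const.mul (contDiff_apply ℝ ℝ i))

theorem hasDerivAt_cos_two_pi (a b t : ℝ) :
    HasDerivAt (fun t : ℝ => Real.cos (2 * Real.pi * (t * a + b)))
      (-(2 * Real.pi * a * Real.sin (2 * Real.pi * (t * a + b)))) t := by
  have h : HasDerivAt (fun t : ℝ => 2 * Real.pi * (t * a + b)) (2 * Real.pi * (1 * a)) t :=
    (((hasDerivAt_id t).mul_const a).add_const b).const_mul _
  convert h.cos using 1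
  ring

theorem hasDerivAt_sin_two_pi (a b t : ℝ) :
    HasDerivAt (fun t : ℝ => Real.sin (2 * Real.pi * (t * a + b)))
      (2 * Real.pi * a * Real.cos (2 * Real.pi * (t * a + b))) t := by
  have h : HasDerivAt (fun t : ℝ => 2 * Real.pi * (t * a + b)) (2 * Real.pi * (1 * a)) t :=
    (((hasDerivAt_id t).mul_const a).add_const b).const_mul _
  convert h.sin using 1
  ring

/-- The derivative of `torusEmbedding` along straight lines. -/
theorem hasDerivAt_torusEmbedding_torusMk (u v : Fin n → ℝ) (t : ℝ) :
    HasDerivAt (fun t : ℝ => (torusEmbedding (torusMk (t • u + v))).ofLp)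
      (fun j => Sum.elim (fun i => -(2 * Real.pi * u i * Real.sin (2 * Real.pi * (t * u i + v i))))
        (fun i => 2 * Real.pi * u i * Real.cos (2 * Real.pi * (t * u i + v i)))
        (finSumFinEquiv.symm j)) t := by
  simp only [torusEmbedding_torusMk]
  rw [hasDerivAt_pi]
  intro j
  rcases finSumFinEquiv.symm j with i | i <;>
    simp only [Sum.elim_inl, Sum.elim_inr, Pi.add_apply, Pi.smul_apply, smul_eq_mul]
  · exact hasDerivAt_cos_two_pi (u i) (v i) t
  · exact hasDerivAt_sin_two_pi (u i) (v i) t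

/-- For `u` in the kernel, the velocity at 0 along `t • u + v` vanishes. Its components are, up to
sign and a factor 2π, `u i` times the sine and the cosine of `2π v i`, which have no common zero. -/
theorem injective_fderiv_torusEmbedding_torusMk (v : Fin n → ℝ) :
    Function.Injective (fderiv ℝ (fun v : Fin n → ℝ => torusEmbedding (torusMk v)) v) := by
  rw [injective_iff_map_eq_zero]
  intro u hu
  have h1 : HasFDerivAt (fun v : Fin n → ℝ => torusEmbedding (torusMk v))
      (fderiv ℝ (fun v : Fin n → ℝ => torusEmbedding (torusMk v)) v) ((0 : ℝ) • u + v) := by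
    rw [zero_smul, zero_add]
    exact (contDiff_torusEmbedding_torusMk.contDiffAt.differentiableAt (by simp)).hasFDerivAt
  have h2 : HasDerivAt (fun t : ℝ => t • u + v) u 0 := by
    simpa using ((hasDerivAt_id (0 : ℝ)).smul_const u).add_const v
  have h3 := h1.comp_hasDerivAt (0 : ℝ) h2
  have h4 := (EuclideanSpace.equiv (Fin (n + n)) ℝ).toContinuousLinearMap.hasFDerivAt.comp_hasDerivAt
    (0 : ℝ) h3
  have h5 := h4.unique (hasDerivAt_torusEmbedding_torusMk u v 0)
  rw [hu] at h5
  funext i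
  have hs := congrFun h5 (finSumFinEquiv (Sum.inl i))
  have hc := congrFun h5 (finSumFinEquiv (Sum.inr i))
  simp only [Equiv.symm_apply_apply, Sum.elim_inl, Sum.elim_inr, map_zero, Pi.zero_apply,
    zero_mul, zero_add] at hs hc
  replace hs : u i = 0 ∨ Real.sin (2 * Real.pi * v i) = 0 := by
    simpa [Real.pi_ne_zero] using hs.symm
  replace hc : u i = 0 ∨ Real.cos (2 * Real.pi * v i) = 0 := by
    simpa [Real.pi_ne_zero] using hc.symm
  by_contra hui
  have hs' := hs.resolve_left hui
  have hc' := hc.resolve_left hui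
  have := Real.sin_sq_add_cos_sq (2 * Real.pi * v i)
  rw [hs', hc'] at this
  norm_num at this

/-- The generator of the linear flow with frequency vector `w` in the coordinates
`(cos 2πθ, sin 2πθ)`. -/
def rotationGenerator (w : Fin n → ℝ) : Matrix (Fin (n + n)) (Fin (n + n)) ℝ :=
  Matrix.reindex finSumFinEquiv finSumFinEquiv
    (Matrix.fromBlocks 0 (-Matrix.diagonal fun i => 2 * Real.pi * w i)
      (Matrix.diagonal fun i => 2 * Real.pi * w i) 0)

theorem rotationGenerator_mulVec (w : Fin n → ℝ) (a b : Fin n → ℝ) :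
    (rotationGenerator w *ᵥ fun j => Sum.elim a b (finSumFinEquiv.symm j)) =
      fun j => Sum.elim (fun i => -(2 * Real.pi * w i * b i)) (fun i => 2 * Real.pi * w i * a i)
        (finSumFinEquiv.symm j) := by
  have h1 : (fun j => Sum.elim a b (finSumFinEquiv.symm j)) =
      Sum.elim a b ∘ finSumFinEquiv.symm := rfl
  rw [rotationGenerator, Matrix.reindex_apply, h1, Matrix.submatrix_mulVec_equiv]
  funext j
  simp only [Function.comp_assoc, Equiv.symm_symm, Equiv.symm_comp_self, Function.comp_id,
    Function.comp_apply, Matrix.fromBlocks_mulVec]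
  rcases finSumFinEquiv.symm j with i | i <;>
    simp [Matrix.mulVec_diagonal]

/-- Each pair (cosine, sine) satisfies the differential equation of a rotation with angular speed
`2π w i`, so an embedded orbit solves `y' = B y`. -/
theorem torusEmbedding_linearFlow (w : Fin n → ℝ) (t : ℝ) (y : UnitAddTorus (Fin n)) :
    torusEmbedding (linearFlow w t y) =
      WithLp.toLp 2 (NormedSpace.exp (t • rotationGenerator w) *ᵥ (torusEmbedding y).ofLp) := by
  obtain ⟨v, rfl⟩ := torusMk_surjective y
  have h := eq_exp_mulVec_of_hasDerivAt (rotationGenerator w)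
    (y := fun t => (torusEmbedding (torusMk (t • w + v))).ofLp) (fun s => by
      have h1 := hasDerivAt_torusEmbedding_torusMk w v s
      convert h1 using 1
      rw [torusEmbedding_torusMk, rotationGenerator_mulVec]
      simp) t
  simp only [zero_smul, zero_add] at h
  rw [← h]
  change torusEmbedding (torusMk (t • w) + torusMk v) = _
  rw [← torusMk_add]

variable {X : Type*} [TopologicalSpace X] [CompactSpace X]
  [ChartedSpace (EuclideanSpace ℝ (Fin n)) X] [IsManifold (𝓡 n) ∞ X]

/-- In the parametrization `h⁻¹ ∘ torusMk` the map becomes `torusEmbedding ∘ torusMk`, whose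
derivative is injective; the complement has dimension `(n + n) - n = n`. Topologically, it is a
continuous injection of a compact space into a Hausdorff one. -/
theorem isSmoothEmbedding_torusEmbedding_comp
    (h : Diffeomorph (𝓡 n) 𝓘(ℝ, Fin n → ℝ) X (UnitAddTorus (Fin n)) ∞) :
    IsSmoothEmbedding (𝓡 n) (𝓡 (n + n)) ∞ (torusEmbedding ∘ h) := by
  refine ⟨⟨EuclideanSpace ℝ (Fin n), inferInstance, inferInstance, fun x => ?_⟩, ?_⟩
  · set L := EuclideanSpace.equiv (Fin n) ℝ with hL
    set q : EuclideanSpace ℝ (Fin n) → X := fun u => h.symm (torusMk (L u)) with hq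
    obtain ⟨v, hv⟩ := torusMk_surjective (h x)
    have hx : q (L.symm v) = x := by
      simp [hq, hv]
    have hcomp : (torusEmbedding ∘ h) ∘ q = (fun v => torusEmbedding (torusMk v)) ∘ L := by
      funext u; simp [hq]
    rw [← hx]
    refine isImmersionAtOfComplement_of_injective_fderiv (by simp) ?_ ?_ ?_
    · exact ((isLocalDiffeomorph_of_continuousLinearEquiv L _).comp _ _
        (isLocalDiffeomorph_torusMk _)).comp _ _ (h.symm.isLocalDiffeomorph _)
    · rw [hcomp]
      exact contDiff_torusEmbedding_torusMk.comp L.contDiff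
    · rw [hcomp, L.comp_right_fderiv]
      exact (injective_fderiv_torusEmbedding_torusMk _).comp L.injective
  · exact ((continuous_torusEmbedding.comp h.continuous).isClosedEmbedding
      (torusEmbedding_injective.comp h.injective)).isEmbedding

theorem SmoothlyConjugate.linearizableBySmoothEmbedding {Φ : Flow ℝ X} {w : Fin n → ℝ}
    (h : SmoothlyConjugate (𝓡 n) 𝓘(ℝ, Fin n → ℝ) Φ (linearFlow w)) :
    LinearizableBySmoothEmbedding (𝓡 n) Φ := by
  obtain ⟨h, hh⟩ := h
  refine ⟨n + n, torusEmbedding ∘ h, rotationGenerator w,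
    isSmoothEmbedding_torusEmbedding_comp h, fun t x => ?_⟩
  simp only [Function.comp_apply]
  rw [hh, torusEmbedding_linearFlow]

end Embedding

end TorusFlow

end

theorem mainTheorem7 {n : ℕ} {X : Type*} [TopologicalSpace X] [T2Space X] [CompactSpace X]
    [ConnectedSpace X] [ChartedSpace (EuclideanSpace ℝ (Fin n)) X] [IsManifold (𝓡 n) ∞ X]
    (Φ : Flow ℝ X) (hΦ : TorusFlow.IsSmoothFlow (𝓡 n) Φ)
    (F : X → UnitAddTorus (Fin n)) (hF : ContMDiff (𝓡 n) 𝓘(ℝ, Fin n → ℝ) ∞ F)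
    (w : Fin n → ℝ) (hw : LinearIndependent ℚ w)
    (hFΦ : ∀ (t : ℝ) (x : X), F (Φ t x) = TorusFlow.torusMk (t • w) + F x) :
    (∃ w' : Fin n → ℝ, LinearIndependent ℚ w' ∧
      TorusFlow.SmoothlyConjugate (𝓡 n) 𝓘(ℝ, Fin n → ℝ) Φ (TorusFlow.linearFlow w')) ∧
    TorusFlow.LinearizableBySmoothEmbedding (𝓡 n) Φ := by
  obtain ⟨w', hw', hconj⟩ := TorusFlow.exists_smoothlyConjugate_linearFlow
    (TorusFlow.isLocalDiffeomorph_of_semiconj hΦ hF hw hFΦ) hw hFΦ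
  exact ⟨⟨w', hw', hconj⟩, hconj.linearizableBySmoothEmbedding⟩
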